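/- Let $f$ be a transcendental entire function (that is, an entire function that is not a polynomial). For $r\ge 0$ put $$M(r)=\max_{|z|=r}|f(z)|,\qquad m(r)=\min_{|z|=r}|f(z)|,$$ and let $m^n$ denote the $n$-th iterate of the function $m:[0,\infty)\to[0,\infty)$. Suppose that $f$ is of order at most $1/2$, minimal type, that is, $$\limsup_{r\to\infty}\frac{\log\log M(r)}{\log r}\le\frac12\qquad\text{and}\qquad \lim_{r\to\infty}\frac{\log M(r)}{r^{1/2}}=0.$$ Suppose also that there exists $r_0>0$ such that, for every $r>r_0$, there is some $s\in(0,r)$ with $$M(s)\ge r^2\qquad\text{and}\qquad \frac{\log M(r)}{r^{1/2}}\le\frac14\,\frac{\log M(s)}{s^{1/2}}.$$ Then there exists $r>0$ such that $m^n(r)\to\infty$ as $n\to\infty$. -/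

import Mathlib

open Filter Topology

namespace EntireGrowth

/-- A transcendental entire function: holomorphic on the whole plane and not a polynomial. -/
def IsTranscendentalEntire (f : ℂ → ℂ) : Prop :=
  Differentiable ℂ f ∧ ¬ ∃ p : Polynomial ℂ, ∀ z, f z = p.eval z

/-- The maximum modulus `M(r) = max {|f(z)| : |z| = r}`, for `r ≥ 0`. -/
noncomputable def maxModulus (f : ℂ → ℂ) (r : ℝ) : ℝ :=
  sSup ((fun z => ‖f z‖) '' Metric.sphere (0 : ℂ) r)

/-- The minimum modulus `m(r) = min {|f(z)| : |z| = r}`, for `r ≥ 0`. -/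
noncomputable def minModulus (f : ℂ → ℂ) (r : ℝ) : ℝ :=
  sInf ((fun z => ‖f z‖) '' Metric.sphere (0 : ℂ) r)

/-- The supremum in `maxModulus` is attained. -/
theorem isGreatest_maxModulus {f : ℂ → ℂ} (hf : Continuous f) {r : ℝ} (hr : 0 ≤ r) :
    IsGreatest ((fun z => ‖f z‖) '' Metric.sphere (0 : ℂ) r) (maxModulus f r) :=
  ((isCompact_sphere (0 : ℂ) r).image hf.norm).isGreatest_sSup
    ((NormedSpace.sphere_nonempty.2 hr).image _)

/-- The infimum in `minModulus` is attained. -/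
theorem isLeast_minModulus {f : ℂ → ℂ} (hf : Continuous f) {r : ℝ} (hr : 0 ≤ r) :
    IsLeast ((fun z => ‖f z‖) '' Metric.sphere (0 : ℂ) r) (minModulus f r) :=
  ((isCompact_sphere (0 : ℂ) r).image hf.norm).isLeast_sInf
    ((NormedSpace.sphere_nonempty.2 hr).image _)

/-- The order `ρ(f) = limsup_{r → ∞} log log M(r) / log r`, in the extended reals. -/
noncomputable def order (f : ℂ → ℂ) : EReal :=
  limsup (fun r : ℝ =>
    ((Real.log (Real.log (maxModulus f r)) / Real.log r : ℝ) : EReal)) atTop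

/-- Order at most `1/2`, minimal type: `ρ(f) ≤ 1/2` and `log M(r) / r^{1/2} → 0` as `r → ∞`. -/
def IsOrderAtMostHalfMinimalType (f : ℂ → ℂ) : Prop :=
  order f ≤ ((1 / 2 : ℝ) : EReal) ∧
    Tendsto (fun r : ℝ => Real.log (maxModulus f r) / r ^ (1 / 2 : ℝ)) atTop (𝓝 0)

end EntireGrowth

/-! The heart is a Milloux–Schmidt inequality (`norm_le_exp_of_forall_exists_norm_le`). Suppose `|F|
≤ 1` on the unit circle and every smaller circle carries a point where `|F| ≤ exp (-B)`.
Symmetrizing `F` (`exists_isSymmetrizationOf`) moves its small values to the negative radius, and a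
two-constants estimate in the slit disc (`norm_sq_le_of_norm_neg_le`) bounds the result on the
positive radius. After rescaling, if `m ≤ r` on `[0, r)`, then `log M(s) - log r ≤ 2 √(s/r) (log
M(r) - log r)`. The growth hypothesis makes the right side less than `(1/2) log M(s)`, so `M(s) <
r²`, a contradiction. Hence the running maximum of `m` eventually exceeds the identity
(`exists_lt_minModulus`).

The rest is one-dimensional dynamics (`exists_tendsto_iterate_atTop`): either `m` itself eventually
exceeds the identity, or there are intervals `[a n, b n]` with `a n → ∞`, each covering the next
under `m`, and some orbit follows them. -/

namespace EntireGrowth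
-- Symmetrization in the unit disc
open Metric Complex ComplexConjugate

/-- `G` is holomorphic and bounded by `1` on the unit disc, and its moduli on the negative and
positive radii bound the modulus of `F` on each circle from below and from above. -/
structure IsSymmetrizationOf (G F : ℂ → ℂ) : Prop where
  differentiableOn : DifferentiableOn ℂ G (ball 0 1)
  norm_le_one : ∀ z ∈ ball (0 : ℂ) 1, ‖G z‖ ≤ 1
  norm_neg_le : ∀ z ∈ ball (0 : ℂ) 1, ‖G (-(‖z‖ : ℂ))‖ ≤ ‖F z‖
  le_norm : ∀ z ∈ ball (0 : ℂ) 1, ‖F z‖ ≤ ‖G (‖z‖ : ℂ)‖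

namespace IsSymmetrizationOf

theorem mul {G F G' F' : ℂ → ℂ} (h : IsSymmetrizationOf G F) (h' : IsSymmetrizationOf G' F') :
    IsSymmetrizationOf (fun z => G z * G' z) (fun z => F z * F' z) where
  differentiableOn := h.differentiableOn.mul h'.differentiableOn
  norm_le_one z hz := by
    rw [norm_mul]
    exact mul_le_one₀ (h.norm_le_one z hz) (norm_nonneg _) (h'.norm_le_one z hz)
  norm_neg_le z hz := by
    rw [norm_mul, norm_mul]
    exact mul_le_mul (h.norm_neg_le z hz) (h'.norm_neg_le z hz) (norm_nonneg _) (norm_nonneg _)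
  le_norm z hz := by
    rw [norm_mul, norm_mul]
    exact mul_le_mul (h.le_norm z hz) (h'.le_norm z hz) (norm_nonneg _) (norm_nonneg _)

theorem one : IsSymmetrizationOf (fun _ => 1) (fun _ => 1) where
  differentiableOn := differentiableOn_const _
  norm_le_one z _ := by simp
  norm_neg_le z _ := by simp
  le_norm z _ := by simp

theorem pow {G F : ℂ → ℂ} (h : IsSymmetrizationOf G F) (n : ℕ) :
    IsSymmetrizationOf (fun z => G z ^ n) (fun z => F z ^ n) := by
  induction n with
  | zero => simpa using one
  | succ n ih => simpa only [pow_succ] using ih.mul h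

theorem congr {G F F' : ℂ → ℂ} (h : IsSymmetrizationOf G F)
    (hF : ∀ z ∈ ball (0 : ℂ) 1, F' z = F z) : IsSymmetrizationOf G F' where
  differentiableOn := h.differentiableOn
  norm_le_one := h.norm_le_one
  norm_neg_le z hz := by rw [hF z hz]; exact h.norm_neg_le z hz
  le_norm z hz := by rw [hF z hz]; exact h.le_norm z hz

end IsSymmetrizationOf

theorem norm_sub_sq_eq (a z : ℂ) :
    ‖z - a‖ ^ 2 = ‖z‖ ^ 2 + ‖a‖ ^ 2 - 2 * (z * conj a).re := by
  rw [← normSq_eq_norm_sq, ← normSq_eq_norm_sq, ← normSq_eq_norm_sq, normSq_sub]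

theorem norm_one_sub_conj_mul_sq (a z : ℂ) :
    ‖1 - conj a * z‖ ^ 2 = 1 + ‖a‖ ^ 2 * ‖z‖ ^ 2 - 2 * (z * conj a).re := by
  rw [← normSq_eq_norm_sq, ← normSq_eq_norm_sq, ← normSq_eq_norm_sq, normSq_sub]
  simp [normSq_mul, mul_comm]

theorem one_sub_conj_mul_ne_zero {a z : ℂ} (ha : ‖a‖ < 1) (hz : ‖z‖ ≤ 1) :
    1 - conj a * z ≠ 0 := by
  intro h
  have h1 : ‖conj a * z‖ = 1 := by rw [← sub_eq_zero.1 h, norm_one]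
  rw [norm_mul, RCLike.norm_conj] at h1
  nlinarith [norm_nonneg a, norm_nonneg z]

theorem norm_sub_le_norm_one_sub_conj_mul {a z : ℂ} (ha : ‖a‖ ≤ 1) (hz : ‖z‖ ≤ 1) :
    ‖z - a‖ ≤ ‖1 - conj a * z‖ := by
  refine (pow_le_pow_iff_left₀ (norm_nonneg _) (norm_nonneg _) two_ne_zero).1 ?_
  rw [norm_sub_sq_eq, norm_one_sub_conj_mul_sq]
  have := mul_nonneg (sub_nonneg.2 (pow_le_one₀ (norm_nonneg a) ha (n := 2)))
    (sub_nonneg.2 (pow_le_one₀ (norm_nonneg z) hz (n := 2)))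
  nlinarith

/-- A Blaschke factor is symmetrized by moving its zero to the negative radius. -/
theorem isSymmetrizationOf_blaschke {a : ℂ} (ha : ‖a‖ < 1) :
    IsSymmetrizationOf (fun z => (z + ‖a‖) / (1 + ‖a‖ * z))
      (fun z => (z - a) / (1 - conj a * z)) := by
  have hρ := norm_nonneg a
  have hden : ∀ z ∈ ball (0 : ℂ) 1, (1 + ‖a‖ * z : ℂ) ≠ 0 := fun z hz => by
    have := one_sub_conj_mul_ne_zero (a := -(‖a‖ : ℂ)) (z := z) (by simpa using ha)
      (by simpa using (mem_ball_zero_iff.1 hz).le)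
    simpa using this
  have hx : ∀ z : ℂ, |(z * conj a).re| ≤ ‖a‖ * ‖z‖ := fun z =>
    (abs_re_le_norm _).trans_eq (by rw [norm_mul, RCLike.norm_conj, mul_comm])
  refine ⟨?_, ?_, ?_, ?_⟩
  · exact DifferentiableOn.div (by fun_prop) (by fun_prop) hden
  · intro z hz
    have h := norm_sub_le_norm_one_sub_conj_mul (a := -(‖a‖ : ℂ)) (z := z) (by simpa using ha.le)
      (by simpa using (mem_ball_zero_iff.1 hz).le)
    rw [norm_div]
    refine div_le_one_of_le₀ (by simpa using h) (norm_nonneg _)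
  · intro z hz
    have hz := mem_ball_zero_iff.1 hz
    have h0 := norm_nonneg z
    have h1 : 0 < 1 - ‖a‖ * ‖z‖ := by nlinarith
    have e1 : ‖(-(‖z‖ : ℂ) + ‖a‖)‖ = |‖a‖ - ‖z‖| := by
      rw [neg_add_eq_sub, ← ofReal_sub, norm_real, Real.norm_eq_abs]
    have e2 : ‖(1 + ‖a‖ * -(‖z‖ : ℂ))‖ = 1 - ‖a‖ * ‖z‖ := by
      have : (1 + ‖a‖ * -(‖z‖ : ℂ)) = ((1 - ‖a‖ * ‖z‖ : ℝ) : ℂ) := by push_cast; ring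
      rw [this, norm_real, Real.norm_of_nonneg h1.le]
    rw [norm_div, norm_div, e1, e2, div_le_div_iff₀ h1
      (norm_pos_iff.2 (one_sub_conj_mul_ne_zero ha hz.le))]
    -- After squaring, the two sides differ by `2 (1 - |a|²)(1 - |z|²)(|a||z| - Re (z ā))`; the
    -- upper bound below has `+ Re (z ā)` instead.
    refine abs_le_of_sq_le_sq' ?_ (by positivity) |>.2
    rw [mul_pow, mul_pow, sq_abs, norm_one_sub_conj_mul_sq, norm_sub_sq_eq]
    have h2 := (abs_le.1 (hx z)).2
    have h3 : 0 ≤ (1 - ‖a‖ ^ 2) * (1 - ‖z‖ ^ 2) :=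
      mul_nonneg (by nlinarith) (by nlinarith)
    nlinarith [mul_nonneg h3 (sub_nonneg.2 h2)]
  · intro z hz
    have hz := mem_ball_zero_iff.1 hz
    have h0 := norm_nonneg z
    have h1 : 0 < 1 + ‖a‖ * ‖z‖ := by positivity
    have e1 : ‖((‖z‖ : ℂ) + ‖a‖)‖ = ‖a‖ + ‖z‖ := by
      rw [← ofReal_add, norm_real, Real.norm_of_nonneg (by positivity), add_comm]
    have e2 : ‖(1 + ‖a‖ * (‖z‖ : ℂ))‖ = 1 + ‖a‖ * ‖z‖ := by
      have : (1 + ‖a‖ * (‖z‖ : ℂ)) = ((1 + ‖a‖ * ‖z‖ : ℝ) : ℂ) := by push_cast; ring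
      rw [this, norm_real, Real.norm_of_nonneg h1.le]
    rw [norm_div, norm_div, e1, e2, div_le_div_iff₀
      (norm_pos_iff.2 (one_sub_conj_mul_ne_zero ha hz.le)) h1]
    refine abs_le_of_sq_le_sq' ?_ (by positivity) |>.2
    rw [mul_pow, mul_pow, norm_one_sub_conj_mul_sq, norm_sub_sq_eq]
    have h2 := (abs_le.1 (hx z)).1
    have h3 : 0 ≤ (1 - ‖a‖ ^ 2) * (1 - ‖z‖ ^ 2) :=
      mul_nonneg (by nlinarith) (by nlinarith)
    nlinarith [mul_nonneg h3 (sub_nonneg.2 h2)]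

/-- A zero-free holomorphic function on a disc has a holomorphic logarithm. -/
theorem exists_exp_eq_of_ne_zero_on_ball {F : ℂ → ℂ} {r : ℝ} (hr : 0 < r)
    (hF : DifferentiableOn ℂ F (ball 0 r)) (h0 : ∀ z ∈ ball (0 : ℂ) r, F z ≠ 0) :
    ∃ q : ℂ → ℂ, DifferentiableOn ℂ q (ball 0 r) ∧ ∀ z ∈ ball (0 : ℂ) r, F z = exp (q z) := by
  have hd : DifferentiableOn ℂ (fun z => deriv F z / F z) (ball 0 r) :=
    (hF.deriv isOpen_ball).div hF h0
  obtain ⟨q, hq0, hq⟩ := hd.isExactOn_ball.with_val_at 0 (log (F 0))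
  refine ⟨q, fun z hz => (hq z hz).differentiableAt.differentiableWithinAt, fun z hz => ?_⟩
  have hder : ∀ w ∈ ball (0 : ℂ) r, HasDerivAt (fun w => F w * exp (-q w)) 0 w := fun w hw => by
    have h1 := (hF.differentiableAt (isOpen_ball.mem_nhds hw)).hasDerivAt
    have h2 := h1.mul (hq w hw).neg.cexp
    have h3 : deriv F w * exp (-q w) + F w * (exp (-q w) * -(deriv F w / F w)) = 0 := by
      field_simp [h0 w hw]
      ring
    exact h3 ▸ h2
  have hconst := isOpen_ball.is_const_of_deriv_eq_zero (convex_ball (0 : ℂ) r).isPreconnected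
    (fun w hw => (hder w hw).differentiableAt.differentiableWithinAt)
    (fun w hw => (hder w hw).deriv) hz (mem_ball_self hr)
  simp only [hq0, exp_neg, exp_log (h0 0 (mem_ball_self hr)),
    mul_inv_cancel₀ (h0 0 (mem_ball_self hr))] at hconst
  exact (mul_inv_eq_one₀ (exp_ne_zero _)).1 hconst

/-- Harnack's inequality for a holomorphic function with nonnegative real part, in the unit disc. -/
theorem harnack_of_re_nonneg {p : ℂ → ℂ} (hp : DifferentiableOn ℂ p (ball 0 1))
    (hre : ∀ z ∈ ball (0 : ℂ) 1, 0 ≤ (p z).re) (h0 : 0 < (p 0).re) {z : ℂ}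
    (hz : z ∈ ball (0 : ℂ) 1) :
    (p z).re * (1 - ‖z‖) ≤ (p 0).re * (1 + ‖z‖) ∧
      (p 0).re * (1 - ‖z‖) ≤ (p z).re * (1 + ‖z‖) := by
  have hz1 := mem_ball_zero_iff.1 hz
  have hden : ∀ w ∈ ball (0 : ℂ) 1, p w + conj (p 0) ≠ 0 := fun w hw h => by
    have := congrArg re h
    simp only [add_re, conj_re, zero_re] at this
    linarith [hre w hw]
  have hsq : ∀ w, ‖p w - p 0‖ ^ 2 = ((p w).re - (p 0).re) ^ 2 + ((p w).im - (p 0).im) ^ 2 :=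
    fun w => by rw [← normSq_eq_norm_sq, normSq_apply]; simp; ring
  have hsq' : ∀ w, ‖p w + conj (p 0)‖ ^ 2 =
      ((p w).re + (p 0).re) ^ 2 + ((p w).im - (p 0).im) ^ 2 :=
    fun w => by rw [← normSq_eq_norm_sq, normSq_apply]; simp; ring
  -- Schwarz lemma for the Cayley transform of `p` that vanishes at `0`. The imaginary parts are
  -- discarded afterwards, since `‖z‖ < 1`.
  have hb : ‖(p z - p 0) / (p z + conj (p 0))‖ ≤ ‖z‖ := by
    refine norm_le_norm_of_mapsTo_ball (f := fun w => (p w - p 0) / (p w + conj (p 0))) (R := 1)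
      ((hp.sub_const _).div (hp.add_const _) hden) (fun w hw => ?_) (by simp) hz1
    rw [mem_closedBall_zero_iff, norm_div]
    refine div_le_one_of_le₀ (abs_le_of_sq_le_sq' ?_ (norm_nonneg _)).2 (norm_nonneg _)
    rw [hsq, hsq']
    nlinarith [mul_nonneg (hre w hw) h0.le]
  rw [norm_div, div_le_iff₀ (norm_pos_iff.2 (hden z hz))] at hb
  have hb2 := pow_le_pow_left₀ (norm_nonneg _) hb 2
  rw [mul_pow, hsq, hsq'] at hb2
  have hx := hre z hz
  have ht := norm_nonneg z
  have hkey : ((p z).re - (p 0).re) ^ 2 ≤ (‖z‖ * ((p z).re + (p 0).re)) ^ 2 := by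
    have : 0 ≤ (1 - ‖z‖ ^ 2) * ((p z).im - (p 0).im) ^ 2 :=
      mul_nonneg (by nlinarith) (sq_nonneg _)
    nlinarith
  have := abs_le_of_sq_le_sq' hkey (by positivity)
  constructor <;> nlinarith [this.1, this.2]

theorem norm_exp_neg_mul_cayley (c : ℝ) {x : ℝ} :
    ‖exp (-(c * ((1 - (x : ℂ)) / (1 + x))))‖ = Real.exp (-(c * ((1 - x) / (1 + x)))) := by
  rw [norm_exp]
  congr 1
  have : (-(c * ((1 - (x : ℂ)) / (1 + x)))) = ((-(c * ((1 - x) / (1 + x))) : ℝ) : ℂ) := by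
    push_cast; rfl
  rw [this, ofReal_re]

/-- Write `F = exp q` with `Re q ≤ 0`. The Harnack bounds for `-Re q` are attained on the real
diameter by `c (1 - z) / (1 + z)`, where `c = -Re q(0)`, so its negative exponential serves as `G`.
-/
theorem exists_isSymmetrizationOf_of_ne_zero {F : ℂ → ℂ} (hF : DifferentiableOn ℂ F (ball 0 1))
    (h1 : ∀ z ∈ ball (0 : ℂ) 1, ‖F z‖ ≤ 1) (h0 : ∀ z ∈ ball (0 : ℂ) 1, F z ≠ 0) :
    ∃ G, IsSymmetrizationOf G F := by
  have hmem := mem_ball_self (x := (0 : ℂ)) one_pos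
  obtain ⟨q, hq, hFq⟩ := exists_exp_eq_of_ne_zero_on_ball one_pos hF h0
  have hnorm : ∀ z ∈ ball (0 : ℂ) 1, ‖F z‖ = Real.exp (q z).re := fun z hz => by
    rw [hFq z hz, norm_exp]
  have hre : ∀ z ∈ ball (0 : ℂ) 1, (q z).re ≤ 0 := fun z hz => by
    have := h1 z hz
    rwa [hnorm z hz, Real.exp_le_one_iff] at this
  rcases (hre 0 hmem).eq_or_lt with hc | hc
  -- If `c = 0`, then `|F|` attains its maximum `1` at the centre and is constant.
  · refine ⟨fun _ => 1, differentiableOn_const _, by simp, ?_, by simpa using h1⟩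
    have hF0 : ‖F 0‖ = 1 := by rw [hnorm 0 hmem, hc, Real.exp_zero]
    intro z hz
    have := norm_eqOn_of_isPreconnected_of_isMaxOn (convex_ball (0 : ℂ) 1).isPreconnected
      isOpen_ball hF hmem (fun w hw => by simpa [hF0] using h1 w hw) hz
    simp only [Function.comp_apply, Function.const_apply, hF0] at this
    simp [this]
  · set c := -(q 0).re with hcdef
    have hc : 0 < c := neg_pos.2 hc
    have hden : ∀ z ∈ ball (0 : ℂ) 1, 1 + z ≠ 0 := fun z hz h => by
      rw [mem_ball_zero_iff, ← neg_eq_of_add_eq_zero_right h] at hz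
      simp at hz
    have hH : ∀ z ∈ ball (0 : ℂ) 1, _ := fun z hz =>
      harnack_of_re_nonneg (p := fun z => -q z) hq.neg (fun z hz => by simpa using hre z hz)
        (by simpa [hcdef] using hc) hz
    simp only [neg_re, ← hcdef] at hH
    refine ⟨fun z => exp (-(c * ((1 - z) / (1 + z)))), ?_, ?_, ?_, ?_⟩
    · have : DifferentiableOn ℂ (fun z : ℂ => (1 - z) / (1 + z)) (ball 0 1) :=
        DifferentiableOn.div (by fun_prop) (by fun_prop) hden
      exact ((this.const_mul (c : ℂ)).neg).cexp
    · intro z hz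
      rw [norm_exp, Real.exp_le_one_iff, neg_re, re_ofReal_mul, div_re]
      have hn := mem_ball_zero_iff.1 hz
      have hs : z.re * z.re + z.im * z.im < 1 := by
        rw [← normSq_apply, normSq_eq_norm_sq]; nlinarith [norm_nonneg z]
      have : 0 ≤ (1 - z).re * (1 + z).re / normSq (1 + z) +
          (1 - z).im * (1 + z).im / normSq (1 + z) := by
        rw [← add_div]
        refine div_nonneg ?_ (normSq_nonneg _)
        simp only [sub_re, one_re, add_re, sub_im, one_im, add_im]
        nlinarith
      nlinarith [mul_nonneg hc.le this]
    · intro z hz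
      have hz1 := mem_ball_zero_iff.1 hz
      have := norm_exp_neg_mul_cayley c (x := -‖z‖)
      push_cast at this
      rw [this, hnorm z hz, Real.exp_le_exp, sub_neg_eq_add, ← sub_eq_add_neg, neg_le, mul_div,
        le_div_iff₀ (by linarith)]
      exact (hH z hz).1
    · intro z hz
      have h0z := norm_nonneg z
      rw [norm_exp_neg_mul_cayley, hnorm z hz, Real.exp_le_exp, le_neg, mul_div,
        div_le_iff₀ (by linarith)]
      exact (hH z hz).2

/-- Iterated `dslope` divides out the zero and leaves an entire cofactor, so the induction on zeros
can stay within entire functions. -/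
theorem exists_eq_pow_mul_ne_zero {F : ℂ → ℂ} (hF : Differentiable ℂ F) (hne : ∃ z, F z ≠ 0)
    (a : ℂ) : ∃ (n : ℕ) (g : ℂ → ℂ), Differentiable ℂ g ∧ g a ≠ 0 ∧
      ∀ z, F z = (z - a) ^ n * g z := by
  obtain ⟨p, hp⟩ := hF.analyticAt a
  have hp0 : p ≠ 0 := fun h => by
    obtain ⟨z, hz⟩ := hne
    have hev := hp.locally_zero_iff.2 h
    have := AnalyticOnNhd.eq_of_eventuallyEq (𝕜 := ℂ) (f := F) (g := fun _ => 0)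
      (fun w _ => hF.analyticAt w) (fun w _ => analyticAt_const) hev
    exact hz (congrFun this z)
  refine ⟨p.order, (Function.swap dslope a)^[p.order] F, ?_,
    hp.iterate_dslope_fslope_ne_zero hp0, fun z => hp.eq_pow_order_mul_iterate_dslope z⟩
  generalize p.order = n
  induction n with
  | zero => exact hF
  | succ n ih =>
    rw [Function.iterate_succ_apply']
    exact differentiableOn_univ.1 ((differentiableOn_dslope univ_mem).2 ih.differentiableOn)

theorem norm_le_one_of_sphere {F : ℂ → ℂ} (hF : Differentiable ℂ F)
    (h1 : ∀ z ∈ sphere (0 : ℂ) 1, ‖F z‖ ≤ 1) {z : ℂ} (hz : z ∈ closedBall (0 : ℂ) 1) :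
    ‖F z‖ ≤ 1 := by
  refine norm_le_of_forall_mem_frontier_norm_le isBounded_ball hF.diffContOnCl
    (U := ball (0 : ℂ) 1) ?_ ?_
  · rwa [frontier_ball _ one_ne_zero]
  · rwa [closure_ball _ one_ne_zero]

/-- Induction on the zeros: each is split off as a power of a Blaschke factor. That factor is
unimodular on the circle, so the cofactor keeps the boundary bound. -/
theorem exists_isSymmetrizationOf_of_zeros_subset (Z : Finset ℂ) :
    ∀ F : ℂ → ℂ, Differentiable ℂ F → (∀ z ∈ sphere (0 : ℂ) 1, ‖F z‖ ≤ 1) → (∃ z, F z ≠ 0) →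
      (∀ z ∈ ball (0 : ℂ) 1, F z = 0 → z ∈ Z) → ∃ G, IsSymmetrizationOf G F := by
  classical
  induction Z using Finset.induction_on with
  | empty =>
    intro F hF h1 _ hZ
    exact exists_isSymmetrizationOf_of_ne_zero hF.differentiableOn
      (fun z hz => norm_le_one_of_sphere hF h1 (ball_subset_closedBall hz))
      (fun z hz h => by simpa using hZ z hz h)
  | insert a Z _ ih =>
    intro F hF h1 hne hZ
    by_cases ha : a ∈ ball (0 : ℂ) 1
    · have ha1 := mem_ball_zero_iff.1 ha
      obtain ⟨n, g, hg, hga, hFg⟩ := exists_eq_pow_mul_ne_zero hF hne a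
      have hden : ∀ z ∈ closedBall (0 : ℂ) 1, 1 - conj a * z ≠ 0 := fun z hz =>
        one_sub_conj_mul_ne_zero ha1 (mem_closedBall_zero_iff.1 hz)
      -- The denominator of the Blaschke factor is absorbed in the cofactor, which therefore remains
      -- entire.
      have hFh : ∀ z ∈ closedBall (0 : ℂ) 1,
          F z = ((z - a) / (1 - conj a * z)) ^ n * ((1 - conj a * z) ^ n * g z) := fun z hz => by
        rw [hFg z, ← mul_assoc, ← mul_pow, div_mul_cancel₀ _ (hden z hz)]
      have hh1 : ∀ z ∈ sphere (0 : ℂ) 1, ‖(1 - conj a * z) ^ n * g z‖ ≤ 1 := fun z hz => by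
        have hzc := sphere_subset_closedBall hz
        have hz1 := mem_sphere_zero_iff_norm.1 hz
        have hb : ‖(z - a) / (1 - conj a * z)‖ = 1 := by
          rw [norm_div, div_eq_one_iff_eq (norm_ne_zero_iff.2 (hden z hzc))]
          refine (pow_left_inj₀ (norm_nonneg _) (norm_nonneg _) two_ne_zero).1 ?_
          rw [norm_one_sub_conj_mul_sq, norm_sub_sq_eq, hz1]
          ring
        have := h1 z hz
        rwa [hFh z hzc, norm_mul, norm_pow, hb, one_pow, one_mul] at this
      have hhZ : ∀ z ∈ ball (0 : ℂ) 1, (1 - conj a * z) ^ n * g z = 0 → z ∈ Z :=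
        fun z hz h => by
          have hg0 : g z = 0 :=
            (mul_eq_zero.1 h).resolve_left (pow_ne_zero _ (hden z (ball_subset_closedBall hz)))
          refine (Finset.mem_insert.1 (hZ z hz (by rw [hFg, hg0, mul_zero]))).resolve_left ?_
          rintro rfl
          exact hga hg0
      obtain ⟨G, hG⟩ := ih (fun z => (1 - conj a * z) ^ n * g z) (by fun_prop) hh1
        ⟨a, mul_ne_zero (pow_ne_zero _ (hden a (ball_subset_closedBall ha))) hga⟩ hhZ
      exact ⟨_, (((isSymmetrizationOf_blaschke ha1).pow n).mul hG).congr
        fun z hz => hFh z (ball_subset_closedBall hz)⟩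
    · refine ih F hF h1 hne fun z hz h => (Finset.mem_insert.1 (hZ z hz h)).resolve_left ?_
      rintro rfl
      exact ha hz

theorem exists_isSymmetrizationOf {F : ℂ → ℂ} (hF : Differentiable ℂ F)
    (h1 : ∀ z ∈ sphere (0 : ℂ) 1, ‖F z‖ ≤ 1) (hne : ∃ z, F z ≠ 0) :
    ∃ G, IsSymmetrizationOf G F := by
  have hfin : {z | z ∈ closedBall (0 : ℂ) 1 ∧ F z = 0}.Finite := by
    by_contra hinf
    obtain ⟨x, -, hx⟩ := Set.Infinite.exists_accPt_of_subset_isCompact hinf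
      (isCompact_closedBall (0 : ℂ) 1) fun z hz => hz.1
    obtain ⟨z, hz⟩ := hne
    have := AnalyticOnNhd.eqOn_zero_of_preconnected_of_frequently_eq_zero (𝕜 := ℂ) (f := F)
      (fun w _ => hF.analyticAt w) isPreconnected_univ (Set.mem_univ x)
      ((accPt_iff_frequently_nhdsNE.1 hx).mono fun w hw => hw.2)
    exact hz (this (Set.mem_univ z))
  exact exists_isSymmetrizationOf_of_zeros_subset hfin.toFinset F hF h1 hne
    fun z hz h => hfin.mem_toFinset.2 ⟨ball_subset_closedBall hz, h⟩

/-! ### Two-constants estimate and the Milloux–Schmidt inequality -/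

/-- The substitution `z = w²` opens the slit disc to a half-disc, where the maximum principle is
applied to `G(w²) exp (B (1 - w/σ)²)`. The real part of `(1 - w/σ)²` is at most `1` on the imaginary
axis, and equals `2 cos θ (cos θ - 1) ≤ 0` on the arc `w = σ exp (iθ)`. It is an explicit substitute
for harmonic measure. -/
theorem norm_sq_le_of_norm_neg_le {G : ℂ → ℂ} (hG : DifferentiableOn ℂ G (ball 0 1))
    (h1 : ∀ z ∈ ball (0 : ℂ) 1, ‖G z‖ ≤ 1) {B : ℝ} (hB : 0 ≤ B)
    (hneg : ∀ t : ℝ, 0 ≤ t → t < 1 → ‖G (-(t : ℂ))‖ ≤ Real.exp (-B)) {y σ : ℝ} (hy : 0 < y)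
    (hyσ : y < σ) (hσ : σ < 1) : ‖G ((y : ℂ) ^ 2)‖ ≤ Real.exp (-(B * (1 - y / σ) ^ 2)) := by
  have hσ0 : 0 < σ := hy.trans hyσ
  set U : Set ℂ := {w | 0 < w.re} ∩ ball 0 σ with hU
  have hcl : closure U ⊆ {w | 0 ≤ w.re} ∩ closedBall 0 σ := by
    refine closure_minimal (fun w hw => ⟨(show 0 < w.re from hw.1).le, ball_subset_closedBall hw.2⟩) ?_
    exact (isClosed_le continuous_const continuous_re).inter isClosed_closedBall
  have hUo : IsOpen U := (isOpen_lt continuous_const continuous_re).inter isOpen_ball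
  have hsq : ∀ w ∈ closedBall (0 : ℂ) σ, w ^ 2 ∈ ball (0 : ℂ) 1 := fun w hw => by
    rw [mem_closedBall_zero_iff] at hw
    rw [mem_ball_zero_iff, norm_pow]
    nlinarith [norm_nonneg w]
  have hnorm : ∀ w : ℂ, ‖exp (B * (1 - w / σ) ^ 2)‖ =
      Real.exp (B * ((1 - w.re / σ) ^ 2 - (w.im / σ) ^ 2)) := fun w => by
    rw [norm_exp, re_ofReal_mul, sq, mul_re]
    simp only [sub_re, one_re, sub_im, one_im, div_ofReal_re, div_ofReal_im]
    ring_nf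
  have hd : DiffContOnCl ℂ (fun w => G (w ^ 2) * exp (B * (1 - w / σ) ^ 2)) U := by
    have : DifferentiableOn ℂ (fun w => G (w ^ 2) * exp (B * (1 - w / σ) ^ 2)) (closure U) := by
      refine DifferentiableOn.mul ?_ (by fun_prop)
      exact hG.comp (by fun_prop) fun w hw => hsq w (hcl hw).2
    exact this.diffContOnCl
  have hmax : ‖G ((y : ℂ) ^ 2) * exp (B * (1 - y / σ) ^ 2)‖ ≤ 1 := by
    refine norm_le_of_forall_mem_frontier_norm_le
      (f := fun w : ℂ => G (w ^ 2) * exp (B * (1 - w / σ) ^ 2))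
      (isBounded_ball.subset Set.inter_subset_right) hd (fun w hw => ?_)
      (subset_closure ⟨by simpa using hy, by simpa [abs_of_pos hy] using hyσ⟩)
    have hwc := hcl hw.1
    have hwU : w ∉ U := by rw [← hUo.interior_eq]; exact hw.2
    have hwn : ‖w‖ ≤ σ := mem_closedBall_zero_iff.1 hwc.2
    rw [norm_mul, hnorm]
    rcases (show 0 ≤ w.re from hwc.1).eq_or_lt with h0 | h0
    · have hw2 : w ^ 2 = -((w.im ^ 2 : ℝ) : ℂ) := by
        apply Complex.ext <;> simp [sq, ← h0]
      have him : w.im ^ 2 < 1 := by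
        have := (abs_im_le_norm w).trans hwn
        rw [← sq_abs]; nlinarith [abs_nonneg w.im]
      rw [hw2, ← h0]
      calc _ ≤ Real.exp (-B) * Real.exp (B * ((1 - 0 / σ) ^ 2 - (w.im / σ) ^ 2)) :=
            mul_le_mul_of_nonneg_right (hneg _ (sq_nonneg _) him) (Real.exp_pos _).le
        _ ≤ 1 := by
            rw [← Real.exp_add, Real.exp_le_one_iff]
            rw [zero_div]
            nlinarith [mul_nonneg hB (sq_nonneg (w.im / σ))]
    · have hwσ : ‖w‖ = σ := le_antisymm hwn
        (not_lt.1 fun h => hwU ⟨h0, mem_ball_zero_iff.2 h⟩)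
      refine mul_le_one₀ (h1 _ (hsq w hwc.2)) (Real.exp_pos _).le ?_
      rw [Real.exp_le_one_iff]
      refine mul_nonpos_of_nonneg_of_nonpos hB ?_
      have hs : (w.re / σ) ^ 2 + (w.im / σ) ^ 2 = 1 := by
        have : w.re ^ 2 + w.im ^ 2 = σ ^ 2 := by
          rw [← hwσ, ← normSq_eq_norm_sq, normSq_apply]; ring
        rw [div_pow, div_pow, ← add_div, this, div_self (by positivity)]
      have ha : 0 ≤ w.re / σ := by positivity
      have ha1 : w.re / σ ≤ 1 := by nlinarith [sq_nonneg (w.im / σ)]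
      nlinarith [mul_nonneg ha (sub_nonneg.2 ha1)]
  rw [norm_mul, hnorm] at hmax
  simp only [ofReal_re, ofReal_im, zero_div] at hmax
  rw [Real.exp_neg, ← one_div, le_div_iff₀ (Real.exp_pos _)]
  simpa using hmax

/-- **Milloux–Schmidt inequality** for entire functions bounded by `1` on the unit circle. -/
theorem norm_le_exp_of_forall_exists_norm_le {F : ℂ → ℂ} (hF : Differentiable ℂ F)
    (h1 : ∀ z ∈ sphere (0 : ℂ) 1, ‖F z‖ ≤ 1) (hne : ∃ z, F z ≠ 0) {B : ℝ} (hB : 0 ≤ B)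
    (hmin : ∀ t : ℝ, 0 ≤ t → t < 1 → ∃ z : ℂ, ‖z‖ = t ∧ ‖F z‖ ≤ Real.exp (-B)) {z : ℂ}
    (hz0 : z ≠ 0) (hz : ‖z‖ < 1) : ‖F z‖ ≤ Real.exp (-(B * (1 - √‖z‖) ^ 2)) := by
  obtain ⟨G, hG⟩ := exists_isSymmetrizationOf hF h1 hne
  have hy : 0 < √‖z‖ := Real.sqrt_pos.2 (norm_pos_iff.2 hz0)
  have hy1 : √‖z‖ < 1 := by rw [Real.sqrt_lt' one_pos]; simpa using hz
  have hsq : ((√‖z‖ : ℝ) : ℂ) ^ 2 = (‖z‖ : ℂ) := by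
    rw [← ofReal_pow, Real.sq_sqrt (norm_nonneg z)]
  refine (hG.le_norm z (mem_ball_zero_iff.2 hz)).trans ?_
  -- `G` is controlled only in the open disc, so the estimate is made at radius `σ < 1` and `σ`
  -- tends to `1`.
  have hlim : Tendsto (fun σ : ℝ => Real.exp (-(B * (1 - √‖z‖ / σ) ^ 2))) (𝓝[<] 1)
      (𝓝 (Real.exp (-(B * (1 - √‖z‖) ^ 2)))) := by
    have : ContinuousAt (fun σ : ℝ => Real.exp (-(B * (1 - √‖z‖ / σ) ^ 2))) 1 := by
      fun_prop (disch := norm_num)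
    simpa [ContinuousAt] using this.tendsto.mono_left nhdsWithin_le_nhds
  refine ge_of_tendsto hlim ?_
  filter_upwards [Ioo_mem_nhdsLT hy1] with σ hσ
  rw [← hsq]
  refine norm_sq_le_of_norm_neg_le hG.differentiableOn hG.norm_le_one hB (fun t ht ht1 => ?_) hy
    hσ.1 hσ.2
  obtain ⟨w, hw, hFw⟩ := hmin t ht ht1
  rw [← hw]
  exact (hG.norm_neg_le w (mem_ball_zero_iff.2 (hw ▸ ht1))).trans hFw

end EntireGrowth

/-! ### Escaping orbits of continuous real maps -/

namespace EntireGrowth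

/-- A continuous map for which each of a sequence of compact intervals covers the next one has an
orbit that follows the intervals. -/
theorem exists_forall_iterate_mem_Icc {g : ℝ → ℝ} (hg : Continuous g) {a b : ℕ → ℝ}
    (hab : ∀ n, a n ≤ b n)
    (hcov : ∀ n, Set.Icc (a (n + 1)) (b (n + 1)) ⊆ g '' Set.Icc (a n) (b n)) :
    ∃ x, ∀ n, g^[n] x ∈ Set.Icc (a n) (b n) := by
  -- Nested compact sets of points that follow the first intervals; pulling points back through the
  -- coverings shows them nonempty.
  set t : ℕ → Set ℝ := fun n => {x | ∀ k ≤ n, g^[k] x ∈ Set.Icc (a k) (b k)} with ht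
  have hback : ∀ n, ∀ y ∈ Set.Icc (a n) (b n), ∃ x ∈ t n, g^[n] x = y := by
    intro n
    induction n with
    | zero => exact fun y hy => ⟨y, fun k hk => by simpa [Nat.le_zero.1 hk] using hy, rfl⟩
    | succ n ih =>
      intro y hy
      obtain ⟨w, hw, rfl⟩ := hcov n hy
      obtain ⟨x, hx, rfl⟩ := ih w hw
      refine ⟨x, fun k hk => ?_, Function.iterate_succ_apply' _ _ _⟩
      rcases Nat.le_succ_iff.1 hk with h | rfl
      · exact hx k h
      · rwa [Function.iterate_succ_apply']
  have hcl : ∀ n, IsClosed (t n) := fun n => by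
    have : t n = ⋂ k, ⋂ _ : k ≤ n, g^[k] ⁻¹' Set.Icc (a k) (b k) := by ext; simp [ht]
    rw [this]
    exact isClosed_iInter fun k => isClosed_iInter fun _ => isClosed_Icc.preimage (hg.iterate k)
  have h0 : IsCompact (t 0) := by
    have : t 0 = Set.Icc (a 0) (b 0) := by ext; simp [ht]
    rw [this]
    exact isCompact_Icc
  obtain ⟨x, hx⟩ := IsCompact.nonempty_iInter_of_sequence_nonempty_isCompact_isClosed t
    (fun n x hx k hk => hx k (hk.trans n.le_succ))
    (fun n => (hback n (a n) ⟨le_rfl, hab n⟩).imp fun x hx => hx.1) h0 hcl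
  exact ⟨x, fun n => Set.mem_iInter.1 hx n n le_rfl⟩

theorem tendsto_iterate_atTop_of_forall_lt {g : ℝ → ℝ} (hg : Continuous g) {R : ℝ}
    (h : ∀ r, R ≤ r → r < g r) : Tendsto (fun n : ℕ => g^[n] R) atTop atTop := by
  have hR : ∀ n, R ≤ g^[n] R := fun n => by
    induction n with
    | zero => exact le_rfl
    | succ n ih => rw [Function.iterate_succ_apply']; exact ih.trans (h _ ih).le
  have hmono : Monotone fun n : ℕ => g^[n] R := monotone_nat_of_le_succ fun n => by
    rw [Function.iterate_succ_apply']; exact (h _ (hR n)).le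
  rcases tendsto_atTop_of_monotone hmono with hT | ⟨l, hl⟩
  · exact hT
  · have hfix := isFixedPt_of_tendsto_iterate hl hg.continuousAt
    exact absurd hfix (h l (ge_of_tendsto' hl hR)).ne'

/-- If the running maximum of a continuous function eventually exceeds the identity, then some
positive point escapes to infinity under iteration. -/
theorem exists_tendsto_iterate_atTop {g : ℝ → ℝ} (hg : Continuous g) {R : ℝ}
    (h : ∀ r, R < r → ∃ t, 0 ≤ t ∧ t < r ∧ r < g t) :
    ∃ r, 0 < r ∧ Tendsto (fun n : ℕ => g^[n] r) atTop atTop := by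
  by_cases hev : ∃ R', ∀ r, R' < r → r < g r
  · obtain ⟨R', hR'⟩ := hev
    exact ⟨max R' 0 + 1, by positivity, tendsto_iterate_atTop_of_forall_lt hg fun r hr =>
      hR' r (by linarith [le_max_left R' 0])⟩
  push Not at hev
  have hargmax : ∀ c : ℝ, 0 ≤ c → ∃ b, 0 ≤ b ∧ b ≤ c ∧ ∀ t, 0 ≤ t → t ≤ c → g t ≤ g b :=
    fun c hc => by
      obtain ⟨b, hb, hmax⟩ := isCompact_Icc.exists_isMaxOn (Set.nonempty_Icc.2 hc) hg.continuousOn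
      exact ⟨b, hb.1, hb.2, fun t h0 ht => hmax ⟨h0, ht⟩⟩
  choose! β hβ0 hβc hβmax using hargmax
  obtain ⟨a₀, ha₀R, ha₀⟩ := hev (max R 0)
  have ha₀0 : 0 < a₀ := (le_max_right _ _).trans_lt ha₀R
  have ha₀R : R < a₀ := (le_max_left _ _).trans_lt ha₀R
  have hβlt : ∀ c, a₀ ≤ c → c < g (β c) := fun c hc => by
    obtain ⟨t, ht0, htc, hgt⟩ := h c (ha₀R.trans_le hc)
    exact hgt.trans_le (hβmax c (ha₀0.le.trans hc) t ht0 htc.le)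
  have hbdd : ∀ K, ∃ C, ∀ t, 0 ≤ t → t ≤ K → g t ≤ C := fun K => by
    obtain ⟨C, hC⟩ := (isCompact_Icc (a := 0) (b := K)).bddAbove_image hg.continuousOn
    exact ⟨C, fun t h0 ht => hC ⟨t, ⟨h0, ht⟩, rfl⟩⟩
  -- Starting above the bound `C₀` of `g` on `[0, a₀]` forces every later maximum point beyond `a₀`.
  obtain ⟨C₀, hC₀⟩ := hbdd a₀
  set c : ℕ → ℝ := fun n => (fun x => g (β x))^[n] (max a₀ C₀) with hc
  have hcsucc : ∀ n, c (n + 1) = g (β (c n)) := fun n => Function.iterate_succ_apply' _ _ _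
  have hca : ∀ n, a₀ ≤ c n := fun n => by
    induction n with
    | zero => exact le_max_left _ _
    | succ n ih => rw [hcsucc]; exact ih.trans (hβlt _ ih).le
  have hcmono : Monotone c := monotone_nat_of_le_succ fun n => by
    rw [hcsucc]; exact (hβlt _ (hca n)).le
  have hc0 : ∀ n, 0 ≤ c n := fun n => ha₀0.le.trans (hca n)
  have hctop : Tendsto c atTop atTop := by
    rcases tendsto_atTop_of_monotone hcmono with hT | ⟨l, hl⟩
    · exact hT
    · exfalso
      obtain ⟨t, ht0, htl, hgt⟩ := h l (ha₀R.trans_le (ge_of_tendsto' hl hca))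
      obtain ⟨n, hn⟩ := (hl.eventually (lt_mem_nhds htl)).exists
      have h1 := hβmax (c n) (hc0 n) t ht0 hn.le
      rw [← hcsucc] at h1
      exact absurd (hcmono.ge_of_tendsto hl (n + 1)) (by linarith)
  set b : ℕ → ℝ := fun n => β (c n) with hb
  have hgb : ∀ n, g (b n) = c (n + 1) := fun n => (hcsucc n).symm
  have hbbig : ∀ K, ∃ n, ∀ m, n ≤ m → K < b m := fun K => by
    obtain ⟨C, hC⟩ := hbdd K
    obtain ⟨n, hn⟩ := (hctop.eventually_gt_atTop C).exists
    refine ⟨n, fun m hm => not_le.1 fun hle => ?_⟩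
    have := hC (b m) (hβ0 _ (hc0 m)) hle
    rw [hgb] at this
    linarith [hcmono (hm.trans m.le_succ)]
  have hba : ∀ n, a₀ ≤ b n := fun n => not_lt.1 fun hlt => by
    have h1 := hC₀ (b n) (hβ0 _ (hc0 n)) hlt.le
    rw [hgb] at h1
    have h2 : C₀ ≤ c n := (le_max_right _ _).trans (hcmono (Nat.zero_le n))
    have h3 := hβlt (c n) (hca n)
    rw [← hcsucc] at h3
    linarith
  have hbmono : ∀ n, b n ≤ b (n + 1) := fun n => not_lt.1 fun hlt => by
    have h1 := hβmax (c n) (hc0 n) (b (n + 1)) (hβ0 _ (hc0 _)) (hlt.le.trans (hβc _ (hc0 n)))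
    rw [hgb, ← hcsucc] at h1
    have h3 := hβlt (c (n + 1)) (hca _)
    rw [← hcsucc] at h3
    linarith
  -- `a n` is the last point of `[a₀, b n]` where `g x ≤ x`. Maximality makes `a` monotone, and
  -- unbounded because such points occur arbitrarily far out.
  have hlast : ∀ n, ∃ a, a ≤ b n ∧ g a ≤ a ∧ ∀ x, a₀ ≤ x → x ≤ b n → g x ≤ x → x ≤ a :=
    fun n => by
      have hK : IsCompact {x | x ∈ Set.Icc a₀ (b n) ∧ g x ≤ x} :=
        isCompact_Icc.inter_right (isClosed_le hg continuous_id)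
      obtain ⟨a, ⟨ha, hga⟩, hmax⟩ := hK.exists_isGreatest ⟨a₀, ⟨le_rfl, hba n⟩, ha₀⟩
      exact ⟨a, ha.2, hga, fun x h0 hx hgx => hmax ⟨⟨h0, hx⟩, hgx⟩⟩
  choose a hab hga hamax using hlast
  have haa : ∀ n, a₀ ≤ a n := fun n => hamax n a₀ le_rfl (hba n) ha₀
  have hamono : ∀ n, a n ≤ a (n + 1) := fun n =>
    hamax (n + 1) (a n) (haa n) ((hab n).trans (hbmono n)) (hga n)
  have hatop : Tendsto a atTop atTop := tendsto_atTop.2 fun K => by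
    obtain ⟨x, hxK, hgx⟩ := hev (max K a₀)
    obtain ⟨n, hn⟩ := hbbig x
    filter_upwards [eventually_ge_atTop n] with m hm
    exact ((le_max_left _ _).trans hxK.le).trans
      (hamax m x ((le_max_right _ _).trans hxK.le) (hn m hm).le hgx)
  -- Covering holds because `g (a n) ≤ a n ≤ a (n + 1)` and `b (n + 1) ≤ c (n + 1) = g (b n)`.
  obtain ⟨x, hx⟩ := exists_forall_iterate_mem_Icc hg hab fun n y hy =>
    intermediate_value_Icc (hab n) hg.continuousOn
      ⟨((hga n).trans (hamono n)).trans hy.1, hy.2.trans ((hβc _ (hc0 _)).trans_eq (hgb n).symm)⟩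
  exact ⟨x, ha₀0.trans_le ((haa 0).trans (hx 0).1), tendsto_atTop_mono (fun n => (hx n).1) hatop⟩

end EntireGrowth

/-! ### Maximum and minimum modulus -/

namespace EntireGrowth
open Metric

theorem norm_le_maxModulus {f : ℂ → ℂ} (hf : Differentiable ℂ f) {r : ℝ} (hr : 0 < r) {z : ℂ}
    (hz : ‖z‖ ≤ r) : ‖f z‖ ≤ maxModulus f r := by
  refine Complex.norm_le_of_forall_mem_frontier_norm_le isBounded_ball hf.diffContOnCl
    (U := ball (0 : ℂ) r) ?_ ?_
  · rw [frontier_ball _ hr.ne']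
    exact fun w hw => (isGreatest_maxModulus hf.continuous hr.le).2 ⟨w, hw, rfl⟩
  · rwa [closure_ball _ hr.ne', mem_closedBall_zero_iff]

theorem minModulus_nonneg (f : ℂ → ℂ) (r : ℝ) : 0 ≤ minModulus f r := by
  refine Real.sInf_nonneg ?_
  rintro _ ⟨z, -, rfl⟩
  exact norm_nonneg _

theorem sphere_eq_image_mul {r : ℝ} (hr : 0 ≤ r) :
    sphere (0 : ℂ) r = (fun u : ℂ => (r : ℂ) * u) '' sphere 0 1 := by
  ext z
  simp only [mem_sphere_zero_iff_norm, Set.mem_image]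
  constructor
  · intro hz
    refine ⟨Complex.exp (z.arg * Complex.I), Complex.norm_exp_ofReal_mul_I _, ?_⟩
    rw [← hz, Complex.norm_mul_exp_arg_mul_I]
  · rintro ⟨u, hu, rfl⟩
    rw [norm_mul, hu, mul_one, Complex.norm_real, Real.norm_of_nonneg hr]

/-- For `r < 0` the sphere is empty and `minModulus f r` takes the default value `0`, which may
create a jump at `0`; the absolute value removes it. Rescaling to the unit circle gives an infimum
over a fixed compact set. -/
theorem continuous_minModulus_abs {f : ℂ → ℂ} (hf : Continuous f) :
    Continuous fun r : ℝ => minModulus f |r| := by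
  have h : (fun r : ℝ => minModulus f |r|) =
      fun r : ℝ => sInf ((fun u : ℂ => ‖f ((|r| : ℝ) * u)‖) '' sphere (0 : ℂ) 1) := by
    funext r
    rw [minModulus, sphere_eq_image_mul (abs_nonneg r), Set.image_image]
  rw [h]
  refine (isCompact_sphere (0 : ℂ) 1).continuous_sInf
    (f := fun (r : ℝ) (u : ℂ) => ‖f ((|r| : ℝ) * u)‖) ?_
  exact (hf.comp ((Complex.continuous_ofReal.comp continuous_fst.abs).mul continuous_snd)).norm

/-- If the minimum modulus does not exceed `μ` on `[0, r)`, the maximum modulus grows at least like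
the square root up to `r`. -/
theorem log_maxModulus_sub_le {f : ℂ → ℂ} (hf : Differentiable ℂ f) {r s μ : ℝ} (hs : 0 < s)
    (hsr : s < r) (hμ : 0 < μ) (hμs : μ ≤ maxModulus f s)
    (hmin : ∀ t, 0 ≤ t → t < r → minModulus f t ≤ μ) :
    Real.log (maxModulus f s) - Real.log μ ≤
      2 * √(s / r) * (Real.log (maxModulus f r) - Real.log μ) := by
  have hr : 0 < r := hs.trans hsr
  obtain ⟨⟨z, hz, hzs⟩, -⟩ := isGreatest_maxModulus hf.continuous hs.le
  have hzs : ‖f z‖ = maxModulus f s := hzs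
  rw [mem_sphere_zero_iff_norm] at hz
  have hMs : 0 < maxModulus f s := hμ.trans_le hμs
  have hsM : maxModulus f s ≤ maxModulus f r :=
    hzs ▸ norm_le_maxModulus hf hr (hz.trans_le hsr.le)
  have hM : 0 < maxModulus f r := hMs.trans_le hsM
  have hrne : (r : ℂ) ≠ 0 := Complex.ofReal_ne_zero.2 hr.ne'
  set B := Real.log (maxModulus f r) - Real.log μ with hB
  have hB0 : 0 ≤ B := sub_nonneg.2 (Real.log_le_log hμ (hμs.trans hsM))
  have hBexp : Real.exp (-B) = μ / maxModulus f r := by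
    rw [hB, neg_sub, Real.exp_sub, Real.exp_log hμ, Real.exp_log hM]
  have hn : ∀ w : ℂ, ‖(r : ℂ) * w‖ = r * ‖w‖ := fun w => by
    rw [norm_mul, Complex.norm_real, Real.norm_of_nonneg hr.le]
  have hF : ∀ w : ℂ, ‖f (r * w) / (maxModulus f r : ℂ)‖ = ‖f (r * w)‖ / maxModulus f r :=
    fun w => by rw [norm_div, Complex.norm_real, Real.norm_of_nonneg hM.le]
  have hzr : (r : ℂ) * (z / r) = z := mul_div_cancel₀ z hrne
  have hnz : ‖z / (r : ℂ)‖ = s / r := by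
    rw [norm_div, Complex.norm_real, Real.norm_of_nonneg hr.le, hz]
  have key := norm_le_exp_of_forall_exists_norm_le (F := fun w => f (r * w) / maxModulus f r)
    ((hf.comp (differentiable_id.const_mul (r : ℂ))).div_const _) (fun w hw => ?_)
    ⟨z / r, ?_⟩ hB0 (fun t ht ht1 => ?_) (z := z / r) ?_ ?_
  · rw [hF, hzr, hzs, hnz, div_le_iff₀ hM] at key
    have h1 := Real.log_le_log hMs key
    rw [Real.log_mul (Real.exp_pos _).ne' hM.ne', Real.log_exp] at h1
    -- With `q = √(s/r)`, the factor `2` comes from `1 - (1 - q)² = 2q - q² ≤ 2q`.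
    nlinarith [mul_nonneg hB0 (sq_nonneg √(s / r))]
  · rw [hF]
    refine div_le_one_of_le₀ (norm_le_maxModulus hf hr ?_) hM.le
    rw [hn, mem_sphere_zero_iff_norm.1 hw, mul_one]
  · refine norm_pos_iff.1 ?_
    rw [hF, hzr, hzs]
    positivity
  · obtain ⟨⟨w, hw, hwm⟩, -⟩ := isLeast_minModulus hf.continuous (r := r * t) (by positivity)
    have hwm : ‖f w‖ = minModulus f (r * t) := hwm
    rw [mem_sphere_zero_iff_norm] at hw
    refine ⟨w / r, ?_, ?_⟩
    · rw [norm_div, Complex.norm_real, Real.norm_of_nonneg hr.le, hw, mul_div_cancel_left₀ _ hr.ne']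
    · rw [hF, mul_div_cancel₀ w hrne, hwm, hBexp]
      exact div_le_div_of_nonneg_right (hmin _ (by positivity) (by nlinarith)) hM.le
  · refine norm_pos_iff.1 ?_
    rw [hnz]
    positivity
  · rw [hnz]
    exact (div_lt_one hr).2 hsr

theorem exists_lt_minModulus {f : ℂ → ℂ} (hf : Differentiable ℂ f) {r s : ℝ} (hs : 0 < s)
    (hsr : s < r) (hr1 : 1 < r) (hMs : r ^ 2 ≤ maxModulus f s)
    (hlog : Real.log (maxModulus f r) / r ^ (1 / 2 : ℝ) ≤
      1 / 4 * (Real.log (maxModulus f s) / s ^ (1 / 2 : ℝ))) :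
    ∃ t, 0 ≤ t ∧ t < r ∧ r < minModulus f t := by
  by_contra! hmin
  have hr : 0 < r := hs.trans hsr
  -- Take `μ = r`. The factors `2` and `1/4` leave `(1/2) log M(s)`, while `M(s) ≥ r²` gives `log
  -- M(s) - log r ≥ (1/2) log M(s)`; the term `-2 √(s/r) log r` makes the contradiction strict.
  have h := log_maxModulus_sub_le hf hs hsr hr (by nlinarith) hmin
  have hlr : 0 < Real.log r := Real.log_pos hr1
  have h2 : 2 * Real.log r ≤ Real.log (maxModulus f s) := by
    have := Real.log_le_log (by positivity) hMs
    rwa [Real.log_pow, Nat.cast_ofNat] at this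
  have hss := Real.sqrt_pos.2 hs
  have hrr := Real.sqrt_pos.2 hr
  rw [← Real.sqrt_eq_rpow, ← Real.sqrt_eq_rpow, div_le_iff₀ hrr] at hlog
  rw [Real.sqrt_div hs.le] at h
  have hq : 0 < √s / √r := div_pos hss hrr
  have e : √s / √r * (1 / 4 * (Real.log (maxModulus f s) / √s) * √r) =
      1 / 4 * Real.log (maxModulus f s) := by field_simp
  have h3 := mul_le_mul_of_nonneg_left hlog hq.le
  rw [e] at h3
  nlinarith [mul_pos hq hlr]

end EntireGrowth

theorem theorem1p2 (f : ℂ → ℂ)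
    (hf : EntireGrowth.IsTranscendentalEntire f)
    (hord : EntireGrowth.IsOrderAtMostHalfMinimalType f)
    (hreg : ∃ r₀ : ℝ, 0 < r₀ ∧ ∀ r : ℝ, r₀ < r →
      ∃ s : ℝ, 0 < s ∧ s < r ∧ r ^ 2 ≤ EntireGrowth.maxModulus f s ∧
        Real.log (EntireGrowth.maxModulus f r) / r ^ (1 / 2 : ℝ) ≤
          1 / 4 * (Real.log (EntireGrowth.maxModulus f s) / s ^ (1 / 2 : ℝ))) :
    ∃ r : ℝ, 0 < r ∧
      Tendsto (fun n : ℕ => (EntireGrowth.minModulus f)^[n] r) atTop atTop := by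
  obtain ⟨r₀, -, hr₀⟩ := hreg
  obtain ⟨r, hr, hT⟩ := EntireGrowth.exists_tendsto_iterate_atTop
    (EntireGrowth.continuous_minModulus_abs hf.1.continuous) (R := max r₀ 1) fun r hr => by
      obtain ⟨s, hs, hsr, hMs, hlog⟩ := hr₀ r ((le_max_left _ _).trans_lt hr)
      obtain ⟨t, ht, htr, hlt⟩ := EntireGrowth.exists_lt_minModulus hf.1 hs hsr
        ((le_max_right _ _).trans_lt hr) hMs hlog
      exact ⟨t, ht, htr, by rwa [abs_of_nonneg ht]⟩
  refine ⟨r, hr, hT.congr fun n => ?_⟩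
  -- Iterates from a positive point stay nonnegative, so the absolute value never acts on the orbit.
  have hn : (fun r : ℝ => EntireGrowth.minModulus f |r|)^[n] r =
      (EntireGrowth.minModulus f)^[n] r ∧ 0 ≤ (EntireGrowth.minModulus f)^[n] r := by
    induction n with
    | zero => exact ⟨rfl, hr.le⟩
    | succ n ih =>
      rw [Function.iterate_succ_apply', Function.iterate_succ_apply', ih.1, abs_of_nonneg ih.2]
      exact ⟨rfl, EntireGrowth.minModulus_nonneg f _⟩
  exact hn.1
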